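/- A finite digraph is a pair $G=(V,E)$, where $V$ is a nonempty finite set and $E\subseteq V^2$ is an arbitrary binary relation on $V$ (loops are allowed). Let $\mathcal{D}$ denote the set of isomorphism types of finite digraphs, and write $G\sqsubseteq G'$ if $G$ is isomorphic to an induced substructure of $G'$ on some nonempty subset of its vertices; $\sqsubseteq$ is a partial order on $\mathcal{D}$. Theorem. The automorphism group of the poset $(\mathcal{D};\sqsubseteq)$ is finite. -/

import Mathlib

/-- A finite directed graph `G = (V, E)`: a nonempty finite vertex set `V` and an arbitrary binary
relation `E ⊆ V²` on it (loops and edges in both directions are allowed). -/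
structure FinDigraph where
  /-- The vertices of the digraph. -/
  V : Type
  [finite_V : Finite V]
  [nonempty_V : Nonempty V]
  /-- The edges of the digraph. -/
  graph : Digraph V

attribute [instance] FinDigraph.finite_V FinDigraph.nonempty_V

namespace FinDigraph

/-- Isomorphism of digraphs: a bijection of the vertices that preserves and reflects edges. -/
def Iso (G H : FinDigraph) : Prop :=
  Nonempty (G.graph.Adj ≃r H.graph.Adj)

/-- The substructure of `G` induced on a nonempty set `s` of its vertices. -/
def induce (G : FinDigraph) (s : Set G.V) (hs : s.Nonempty) : FinDigraph where
  V := s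
  nonempty_V := hs.to_subtype
  graph := ⟨fun a b => G.graph.Adj a b⟩

/-- `G` is a substructure of `H`: it is isomorphic to an induced substructure of `H`
on some set of vertices. -/
def IsSubstructure (G H : FinDigraph) : Prop :=
  ∃ (s : Set H.V) (hs : s.Nonempty), G.Iso (H.induce s hs)

theorem isSubstructure_iff (G H : FinDigraph) :
    G.IsSubstructure H ↔ Nonempty (G.graph.Adj ↪r H.graph.Adj) := by
  constructor
  · rintro ⟨s, hs, ⟨e⟩⟩
    exact ⟨⟨⟨fun v => (e v : s).1, fun a b h => e.injective (Subtype.ext h)⟩,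
      fun {a b} => e.map_rel_iff (a := a) (b := b)⟩⟩
  · rintro ⟨f⟩
    exact ⟨Set.range f, Set.range_nonempty f,
      ⟨⟨Equiv.ofInjective f f.injective, fun {a b} => f.map_rel_iff (a := a) (b := b)⟩⟩⟩

theorem IsSubstructure.refl (G : FinDigraph) : G.IsSubstructure G :=
  (isSubstructure_iff G G).2 ⟨RelEmbedding.refl _⟩

theorem IsSubstructure.trans {G H K : FinDigraph} (h₁ : G.IsSubstructure H)
    (h₂ : H.IsSubstructure K) : G.IsSubstructure K := by
  obtain ⟨f⟩ := (isSubstructure_iff G H).1 h₁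
  obtain ⟨g⟩ := (isSubstructure_iff H K).1 h₂
  exact (isSubstructure_iff G K).2 ⟨f.trans g⟩

theorem Iso.isSubstructure {G H : FinDigraph} (h : G.Iso H) : G.IsSubstructure H :=
  (isSubstructure_iff G H).2 (h.map fun e => e.toRelEmbedding)

theorem IsSubstructure.antisymm {G H : FinDigraph} (h₁ : G.IsSubstructure H)
    (h₂ : H.IsSubstructure G) : G.Iso H := by
  obtain ⟨f⟩ := (isSubstructure_iff G H).1 h₁
  obtain ⟨g⟩ := (isSubstructure_iff H G).1 h₂
  have hcard : Nat.card G.V = Nat.card H.V :=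
    le_antisymm (Nat.card_le_card_of_injective f f.injective)
      (Nat.card_le_card_of_injective g g.injective)
  have hbij : Function.Bijective f :=
    (Nat.bijective_iff_injective_and_card f).2 ⟨f.injective, hcard⟩
  exact ⟨RelIso.ofSurjective f hbij.surjective⟩

/-- Isomorphism as an equivalence relation. -/
instance isoSetoid : Setoid FinDigraph where
  r := Iso
  iseqv :=
    { refl := fun _ => ⟨RelIso.refl _⟩
      symm := fun h => h.map RelIso.symm
      trans := fun ⟨e⟩ ⟨f⟩ => ⟨e.trans f⟩ }

end FinDigraph

/-- The set `𝒟` of isomorphism types of finite digraphs. -/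
def DigraphType : Type 1 := Quotient FinDigraph.isoSetoid

namespace DigraphType

/-- The isomorphism type of a finite digraph. -/
def mk (G : FinDigraph) : DigraphType := Quotient.mk FinDigraph.isoSetoid G

/-- The partial order `⊑` on `𝒟`, written `≤` here: being a substructure. -/
instance : PartialOrder DigraphType where
  le := Quotient.lift₂ FinDigraph.IsSubstructure fun _ _ _ _ h₁ h₂ => propext
    ⟨fun h => ((Setoid.symm h₁ : FinDigraph.Iso _ _).isSubstructure.trans h).trans
        (FinDigraph.Iso.isSubstructure h₂),
      fun h => ((FinDigraph.Iso.isSubstructure h₁).trans h).trans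
        (Setoid.symm h₂ : FinDigraph.Iso _ _).isSubstructure⟩
  le_refl := by
    rintro ⟨G⟩
    exact FinDigraph.IsSubstructure.refl G
  le_trans := by
    rintro ⟨G⟩ ⟨H⟩ ⟨K⟩ h₁ h₂
    exact FinDigraph.IsSubstructure.trans h₁ h₂
  le_antisymm := by
    rintro ⟨G⟩ ⟨H⟩ h₁ h₂
    exact Quotient.sound (FinDigraph.IsSubstructure.antisymm h₁ h₂)

theorem mk_le_mk (G H : FinDigraph) : mk G ≤ mk H ↔ G.IsSubstructure H := Iff.rfl

theorem mk_eq_mk (G H : FinDigraph) : mk G = mk H ↔ G.Iso H :=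
  ⟨fun h => Quotient.exact h, fun h => Quotient.sound h⟩

end DigraphType

/-!
Automorphisms preserve the number of vertices, so it suffices that an automorphism `φ` fixing the
finitely many digraphs with at most four vertices is the identity.

Such a `φ` fixes the chains, that is, the reflexive linear orders, because these are recognized by
their triples of vertices. A word of length at least three is determined by its subwords with one
letter less, and reading the edges along the chain as a word, one finds that joins of a chain with
at most two vertices are fixed. A chain that embeds into a join with a digraph `ρ` in one way only,
and whose edges tell the vertices of `ρ` apart, serves as a coordinate system: the join is then
determined by the parts spanned by the chain and two further vertices, hence it is fixed. Every
loopless `ρ` is part of such a join, as its loopless part, and is therefore fixed too.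

Complementation of the loops is an automorphism, so in general one may assume that `ρ` has at least
as many loopless vertices as looped ones. Choose a join of `ρ` with a chain as above in which the
labels of the edges from each chain vertex to the loopless vertices have frequencies that no looped
vertex of `ρ` dominates. Such frequencies exist by counting, and `φ` preserves the relevant ones, as
it fixes the joins of a loop with a loopless digraph that have only one label. As `φ ρ` is part of
the fixed join, it avoids the chain, and `φ ρ = ρ`.
-/

open Function

section Words

variable {α : Type*}

open List

theorem cons_eq_of_cons_sublist_cons_of_ne {a b : α} {p v : List α} (hab : a ≠ b)
    (hp : p.length + 1 = v.length) (h : a :: p <+ b :: v) : a :: p = v :=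
  ((cons_sublist_cons'.1 h).resolve_right fun h => hab h.1).eq_of_length hp

theorem head_eq_of_sublist_iff {a b : α} {u v : List α} (huv : u.length = v.length)
    (hu : 2 ≤ u.length)
    (h : ∀ p : List α, p.length = u.length → (p <+ a :: u ↔ p <+ b :: v)) : a = b := by
  by_contra hab
  have hv (p : List α) (hp : p.length + 1 = u.length) (hpu : p <+ u) : a :: p = v :=
    cons_eq_of_cons_sublist_cons_of_ne hab (hp.trans huv) ((h (a :: p) hp).1 (hpu.cons_cons a))
  have hu' (p : List α) (hp : p.length + 1 = v.length) (hpv : p <+ v) : b :: p = u :=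
    cons_eq_of_cons_sublist_cons_of_ne (Ne.symm hab) (hp.trans huv.symm)
      ((h (b :: p) (hp.trans huv.symm)).2 (hpv.cons_cons b))
  match u, hu with
  | x :: y :: u, _ =>
    obtain rfl : x = y := by
      have := (hv (x :: u) rfl ((sublist_cons_self y u).cons_cons x)).trans
        (hv (y :: u) rfl (sublist_cons_self x _)).symm
      grind
    obtain rfl := hv (x :: u) rfl (sublist_cons_self x _)
    have hb := hu' (x :: u) rfl (sublist_cons_self a _)
    have ha := hu' (a :: u) rfl ((sublist_cons_self x u).cons_cons a)
    grind

theorem pair_sublist_triple_iff {a b c x y : α} :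
    [b, c] <+ [a, x, y] ↔ b = a ∧ c = x ∨ b = a ∧ c = y ∨ b = x ∧ c = y := by
  simp only [cons_sublist_cons', sublist_nil]
  grind

theorem list_eq_of_sublist_iff (l l' : List α) (hlen : l.length = l'.length) (h3 : 3 ≤ l.length)
    (h : ∀ p : List α, p.length + 1 = l.length → (p <+ l ↔ p <+ l')) : l = l' := by
  induction l generalizing l' with
  | nil => simp at h3
  | cons a u ih =>
    obtain _ | ⟨b, v⟩ := l'
    · simp at hlen
    simp only [length_cons, Nat.add_right_cancel_iff] at hlen h3 h
    obtain rfl : a = b := head_eq_of_sublist_iff hlen (by omega) h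
    obtain hu | hu : u.length = 2 ∨ 3 ≤ u.length := by omega
    · obtain ⟨x, y, rfl⟩ := length_eq_two.1 hu
      obtain ⟨x', y', rfl⟩ := length_eq_two.1 (hlen.symm.trans hu)
      have hpair (b c : α) := h [b, c] rfl
      simp only [pair_sublist_triple_iff] at hpair
      grind
    · rw [ih v hlen hu fun p hp => by simpa using h (a :: p) (by simpa using hp)]

theorem exists_comp_eq_iff_ofFn_sublist {k m : ℕ} {u : Fin k → α} {w : Fin m → α} :
    (∃ g : Fin k ↪o Fin m, u = w ∘ g) ↔ ofFn u <+ ofFn w := by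
  rw [sublist_iff_exists_fin_orderEmbedding_get_eq]
  let e : Fin (ofFn u).length ≃o Fin k := Fin.castOrderIso length_ofFn
  let e' : Fin (ofFn w).length ≃o Fin m := Fin.castOrderIso length_ofFn
  simp only [get_ofFn]
  constructor
  · rintro ⟨g, rfl⟩
    exact ⟨(e.toOrderEmbedding.trans g).trans e'.symm.toOrderEmbedding, fun i => rfl⟩
  · rintro ⟨g, hg⟩
    exact ⟨(e.symm.toOrderEmbedding.trans g).trans e'.toOrderEmbedding,
      funext fun i => hg (e.symm i)⟩

theorem eq_of_exists_comp_eq_iff {m : ℕ} (hm : 2 ≤ m) {w w' : Fin (m + 1) → α}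
    (h : ∀ u : Fin m → α, (∃ g : Fin m ↪o Fin (m + 1), u = w ∘ g) ↔
      ∃ g : Fin m ↪o Fin (m + 1), u = w' ∘ g) : w = w' := by
  refine ofFn_injective (list_eq_of_sublist_iff _ _ (by simp) (by simpa using hm) fun p hp => ?_)
  obtain rfl : p.length = m := by simpa using hp
  simpa only [exists_comp_eq_iff_ofFn_sublist, ofFn_get] using h p.get

end Words

section Dominance

variable {A B L : Type*} [Finite A]

theorem ncard_fiber_add_le (f : A → L) {x y z : L} (hxy : x ≠ y) (hxz : x ≠ z) (hyz : y ≠ z) :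
    (f ⁻¹' {x}).ncard + (f ⁻¹' {y}).ncard + (f ⁻¹' {z}).ncard ≤ Nat.card A := by
  have hdisj {x y : L} (h : x ≠ y) : Disjoint (f ⁻¹' {x}) (f ⁻¹' {y}) :=
    (Set.disjoint_singleton.2 h).preimage f
  rw [← Set.ncard_union_eq (hdisj hxy),
    ← Set.ncard_union_eq ((hdisj hxz).union_left (hdisj hyz))]
  exact Set.ncard_le_card _

/-- Already the words with two letters, one of them a fixed one, suffice: their frequencies take
`2 * (Nat.card A - 1)` values, and no word dominates two of these. -/
theorem exists_word_not_dominated [Finite B] [Fintype L] (hA : 3 ≤ Nat.card A)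
    (hBA : Nat.card B ≤ Nat.card A) (hL : 2 < Fintype.card L) (v : B → A → L) :
    ∃ u : A → L, (∃ x y, u x ≠ u y) ∧ ∀ b, ∃ c, (v b ⁻¹' {c}).ncard < (u ⁻¹' {c}).ncard := by
  classical
  by_contra! hdom
  obtain ⟨c, c₀, c₁, h₀, h₁, h₀₁⟩ := Fintype.two_lt_card_iff.1 hL
  let d (t : Bool) : L := bif t then c₁ else c₀
  have hcd (t : Bool) : c ≠ d t := by
    cases t
    exacts [h₀, h₁]
  have hex (p : Fin (Nat.card A - 1) × Bool) : ∃ b, p.1 + 1 ≤ (v b ⁻¹' {c}).ncard ∧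
      Nat.card A - (p.1 + 1) ≤ (v b ⁻¹' {d p.2}).ncard := by
    obtain ⟨T, -, hT⟩ := Set.exists_subset_card_eq (s := (Set.univ : Set A)) (n := p.1 + 1)
      (by rw [Set.ncard_univ]; omega)
    have hT' := Set.ncard_add_ncard_compl T
    obtain ⟨x, hx⟩ : T.Nonempty := Set.nonempty_of_ncard_ne_zero (by omega)
    obtain ⟨y, hy⟩ : Tᶜ.Nonempty := Set.nonempty_of_ncard_ne_zero (by omega)
    let u (a : A) : L := if a ∈ T then c else d p.2
    obtain ⟨b, hb⟩ := hdom u ⟨x, y, by simpa [u, hx, Set.notMem_of_mem_compl hy] using hcd p.2⟩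
    have hc : T.ncard ≤ (u ⁻¹' {c}).ncard := Set.ncard_le_ncard fun a ha => if_pos ha
    have hd : Tᶜ.ncard ≤ (u ⁻¹' {d p.2}).ncard := Set.ncard_le_ncard fun a ha => if_neg ha
    exact ⟨b, hT ▸ hc.trans (hb c), by have := hd.trans (hb (d p.2)); omega⟩
  choose f hf using hex
  have hinj : Injective f := by
    rintro ⟨k, t⟩ ⟨k', t'⟩ hff
    have h := hf (k, t)
    have h' := hf (k', t')
    rw [← hff] at h'
    have hsum := ncard_fiber_add_le (v (f (k, t))) h₀ h₁ h₀₁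
    have := k.2
    have := k'.2
    cases t <;> cases t' <;> simp only [d, cond_true, cond_false] at h h' <;> grind
  have := Nat.card_le_card_of_injective f hinj
  rw [Nat.card_prod, Nat.card_fin, Nat.card_eq_fintype_card (α := Bool), Fintype.card_bool] at this
  omega

end Dominance

section RelEmbedding

variable {α β γ : Type*} {r : α → α → Prop} {s : β → β → Prop} {t : γ → γ → Prop}

theorem nonempty_relEmbedding_of_range_subset (f : r ↪r t) (g : s ↪r t)
    (h : Set.range f ⊆ Set.range g) : Nonempty (r ↪r s) := by
  choose k hk using fun a => h ⟨a, rfl⟩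
  refine ⟨⟨⟨k, fun a b hab => f.injective ?_⟩, fun {a b} => ?_⟩⟩
  · rw [← hk, ← hk, hab]
  · rw [← f.map_rel_iff, ← hk, ← hk]
    exact g.map_rel_iff.symm

theorem orderEmbedding_self_apply {α : Type*} [LinearOrder α] [Finite α] (f : α ↪o α) (a : α) :
    f a = a :=
  DFunLike.congr_fun (Subsingleton.elim
    (RelIso.ofSurjective f (Finite.injective_iff_surjective.1 f.injective)) (OrderIso.refl α)) a

theorem eq_of_le_iff_le {α : Type*} [LinearOrder α] {a b : α} (h : a ≤ b ↔ b ≤ a) : a = b :=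
  (le_total a b).elim (fun hab => hab.antisymm (h.1 hab)) fun hba => (h.2 hba).antisymm hba

/-- The loop, or the absence of a loop, at a single vertex. -/
def unitEmbedding (r : α → α → Prop) (a : α) : (fun _ _ : Unit => r a a) ↪r r :=
  ⟨⟨fun _ => a, fun _ _ _ => rfl⟩, Iff.rfl⟩

/-- The loopless part of a relation: its restriction to the elements not related to themselves. -/
abbrev looplessPart (r : α → α → Prop) : {a // ¬ r a a} → {a // ¬ r a a} → Prop :=
  Subrel r fun a => ¬ r a a

end RelEmbedding

section Join

variable {α β α' β' γ : Type*} {r : α → α → Prop} {s : β → β → Prop} {r' : α' → α' → Prop}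
  {s' : β' → β' → Prop} {t : γ → γ → Prop} {w : α → β → Prop × Prop} {w' : α' → β' → Prop × Prop}

/-- The label of the pair `(x, y)`: whether there is an edge from `x` to `y`, and whether there is
one back. -/
def edgeLabel (t : γ → γ → Prop) (x y : γ) : Prop × Prop := (t x y, t y x)

/-- The relation on `α ⊕ β` that restricts to `r` and `s` on the two parts and whose edges between
`a : α` and `b : β` have the label `w a b`, in the sense of `edgeLabel`. -/
def join (r : α → α → Prop) (w : α → β → Prop × Prop) (s : β → β → Prop) :
    α ⊕ β → α ⊕ β → Prop
  | .inl a, .inl a' => r a a'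
  | .inl a, .inr b => (w a b).1
  | .inr b, .inl a => (w a b).2
  | .inr b, .inr b' => s b b'

@[simp] theorem join_inl_inr {a : α} {b : β} : join r w s (.inl a) (.inr b) ↔ (w a b).1 := Iff.rfl

@[simp] theorem join_inr_inl {a : α} {b : β} : join r w s (.inr b) (.inl a) ↔ (w a b).2 := Iff.rfl

theorem edgeLabel_map (f : s ↪r t) (x y : β) : edgeLabel t (f x) (f y) = edgeLabel s x y :=
  Prod.ext (propext f.map_rel_iff) (propext f.map_rel_iff)

/-- The first part of a join. -/
def joinInl (r : α → α → Prop) (w : α → β → Prop × Prop) (s : β → β → Prop) : r ↪r join r w s :=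
  ⟨.inl, Iff.rfl⟩

/-- The second part of a join. -/
def joinInr (r : α → α → Prop) (w : α → β → Prop × Prop) (s : β → β → Prop) : s ↪r join r w s :=
  ⟨.inr, Iff.rfl⟩

@[simp] theorem joinInl_apply (a : α) : joinInl r w s a = .inl a := rfl

/-- The embedding of a join given by embeddings of its parts with disjoint ranges. -/
def joinElim (f : r ↪r t) (g : s ↪r t) (hd : ∀ a b, f a ≠ g b)
    (hw : ∀ a b, w a b = edgeLabel t (f a) (g b)) : join r w s ↪r t where
  toFun := Sum.elim f g
  inj' := f.injective.sumElim g.injective hd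
  map_rel_iff' := by
    rintro (a | b) (a' | b')
    exacts [f.map_rel_iff, by simp [hw, edgeLabel], by simp [hw, edgeLabel], g.map_rel_iff]

/-- The embedding of joins given by embeddings of the parts that preserve the labels. -/
def joinMap (f : r ↪r r') (g : s ↪r s') (hw : ∀ a b, w a b = w' (f a) (g b)) :
    join r w s ↪r join r' w' s' :=
  joinElim (f.trans (joinInl r' w' s')) (g.trans (joinInr r' w' s')) (fun _ _ => Sum.inl_ne_inr) hw

theorem exists_eq_inl_of_join_self (hs : ∀ b, ¬ s b b) {x : α ⊕ β} (hx : join r w s x x) :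
    ∃ a, x = .inl a := by
  rcases x with a | b
  exacts [⟨a, rfl⟩, absurd hx (hs b)]

theorem exists_eq_inr_of_not_join_self (hr : ∀ a, r a a) {x : α ⊕ β} (hx : ¬ join r w s x x) :
    ∃ b, x = .inr b ∧ ¬ s b b := by
  rcases x with a | b
  exacts [absurd (hr a) hx, ⟨b, rfl, hx⟩]

/-- Loops tell the two parts apart. -/
theorem exists_joinMap_of_refl_irrefl (hr : ∀ a, r a a) (hr' : ∀ a, r' a a) (hs : ∀ b, ¬ s b b)
    (hs' : ∀ b, ¬ s' b b) (γ : join r w s ↪r join r' w' s') :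
    ∃ (f : r ↪r r') (g : s ↪r s'), ∀ a b, w a b = w' (f a) (g b) := by
  choose f hf using fun a =>
    exists_eq_inl_of_join_self hs' ((γ.map_rel_iff (a := .inl a) (b := .inl a)).2 (hr a))
  choose g hg _ using fun b => exists_eq_inr_of_not_join_self hr'
    (mt (γ.map_rel_iff (a := .inr b) (b := .inr b)).1 (hs b))
  refine ⟨⟨⟨f, fun a a' h => ?_⟩, fun {a a'} => ?_⟩, ⟨⟨g, fun b b' h => ?_⟩, fun {b b'} => ?_⟩,
    fun a b => ?_⟩
  · exact Sum.inl_injective (γ.injective (by rw [hf, hf, h]))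
  · have := γ.map_rel_iff (a := .inl a) (b := .inl a')
    rwa [hf, hf] at this
  · exact Sum.inr_injective (γ.injective (by rw [hg, hg, h]))
  · have := γ.map_rel_iff (a := .inr b) (b := .inr b')
    rwa [hg, hg] at this
  · have := edgeLabel_map γ (.inl a) (.inr b)
    rw [hf, hg] at this
    exact this.symm

theorem exists_embedding_of_map_inl {w' : α → β' → Prop × Prop}
    (κ : join r w s ↪r join r w' s') (hκ : ∀ a, κ (.inl a) = .inl a) :
    ∃ g : s ↪r s', ∀ a b, w' a (g b) = w a b := by
  have hinr (b : β) : ∃ b', κ (.inr b) = .inr b' := by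
    rcases hb : κ (.inr b) with a | b'
    · exact absurd (κ.injective (hb.trans (hκ a).symm)) Sum.inr_ne_inl
    · exact ⟨b', rfl⟩
  choose g hg using hinr
  refine ⟨⟨⟨g, fun b b' h => ?_⟩, fun {b b'} => ?_⟩, fun a b => ?_⟩
  · exact Sum.inr_injective (κ.injective (by rw [hg, hg, h]))
  · have := κ.map_rel_iff (a := .inr b) (b := .inr b')
    rwa [hg, hg] at this
  · have := edgeLabel_map κ (.inl a) (.inr b)
    rwa [hκ, hg] at this

end Join

namespace DigraphType

/-- The isomorphism type of a binary relation on a nonempty finite type. -/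
def ofRel {V : Type} [Finite V] [Nonempty V] (r : V → V → Prop) : DigraphType :=
  mk { V := V, graph := ⟨r⟩ }

theorem exists_eq_ofRel (x : DigraphType) :
    ∃ (V : Type) (_ : Finite V) (_ : Nonempty V) (r : V → V → Prop), x = ofRel r := by
  obtain ⟨G⟩ := x
  exact ⟨G.V, G.finite_V, G.nonempty_V, G.graph.Adj, rfl⟩

section Size

variable {V W : Type} [Finite V] [Nonempty V] [Finite W] [Nonempty W] {r : V → V → Prop}
  {s : W → W → Prop}

theorem ofRel_le_ofRel : ofRel r ≤ ofRel s ↔ Nonempty (r ↪r s) :=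
  (mk_le_mk _ _).trans (FinDigraph.isSubstructure_iff _ _)

theorem ofRel_eq_ofRel : ofRel r = ofRel s ↔ Nonempty (r ≃r s) := mk_eq_mk _ _

theorem ofRel_le_of_embedding (f : r ↪r s) : ofRel r ≤ ofRel s := ofRel_le_ofRel.2 ⟨f⟩

theorem ofRel_le_of_range_subset {γ : Type*} {t : γ → γ → Prop} (f : r ↪r t) (g : s ↪r t)
    (h : Set.range f ⊆ Set.range g) : ofRel r ≤ ofRel s :=
  ofRel_le_ofRel.2 (nonempty_relEmbedding_of_range_subset f g h)

/-- The number of vertices. It is the rank function of the poset of digraphs, which is why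
automorphisms preserve it. -/
noncomputable def size : DigraphType → ℕ :=
  Quotient.lift (fun G => Nat.card G.V) fun _ _ ⟨e⟩ => Nat.card_congr e.toEquiv

theorem size_ofRel : size (ofRel r) = Nat.card V := rfl

theorem size_pos (x : DigraphType) : 0 < size x := by
  obtain ⟨V, _, _, r, rfl⟩ := exists_eq_ofRel x
  exact Nat.card_pos

theorem size_mono : Monotone size := by
  intro x y h
  obtain ⟨V, _, _, r, rfl⟩ := exists_eq_ofRel x
  obtain ⟨W, _, _, s, rfl⟩ := exists_eq_ofRel y
  obtain ⟨f⟩ := ofRel_le_ofRel.1 h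
  exact Nat.card_le_card_of_injective f f.injective

theorem eq_of_le_of_size_le {x y : DigraphType} (h : x ≤ y) (hs : size y ≤ size x) : x = y := by
  obtain ⟨V, _, _, r, rfl⟩ := exists_eq_ofRel x
  obtain ⟨W, _, _, s, rfl⟩ := exists_eq_ofRel y
  obtain ⟨f⟩ := ofRel_le_ofRel.1 h
  have hf : Bijective f :=
    (Nat.bijective_iff_injective_and_card f).2 ⟨f.injective, le_antisymm (size_mono h) hs⟩
  exact ofRel_eq_ofRel.2 ⟨RelIso.ofSurjective f hf.surjective⟩

theorem size_strictMono : StrictMono size := fun _ _ h =>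
  lt_of_not_ge fun hs => h.ne (eq_of_le_of_size_le h.le hs)

theorem exists_lt_size_eq {x : DigraphType} {n : ℕ} (h0 : 0 < n) (hn : n < size x) :
    ∃ y < x, size y = n := by
  obtain ⟨V, _, _, r, rfl⟩ := exists_eq_ofRel x
  obtain ⟨S, -, hS⟩ := Set.exists_subset_card_eq (s := (Set.univ : Set V)) (n := n)
    (by rw [Set.ncard_univ]; exact hn.le)
  have : Nonempty S := (Set.nonempty_of_ncard_ne_zero (by omega)).to_subtype
  have hsize : size (ofRel (Subrel r (· ∈ S))) = n := (Nat.card_coe_set_eq S).trans hS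
  have hle : ofRel (Subrel r (· ∈ S)) ≤ ofRel r := ofRel_le_of_embedding (Subrel.relEmbedding r _)
  exact ⟨_, hle.lt_of_ne fun h => by rw [← h, hsize] at hn; exact hn.false, hsize⟩

theorem finite_size_le (N : ℕ) : Finite {x : DigraphType // size x ≤ N} := by
  let f (p : Σ n : Fin N, Fin (n + 1) → Fin (n + 1) → Prop) : {x : DigraphType // size x ≤ N} :=
    ⟨ofRel p.2, by rw [size_ofRel, Nat.card_fin]; exact p.1.2⟩
  refine Finite.of_surjective f ?_
  rintro ⟨x, hx⟩
  obtain ⟨V, _, _, r, rfl⟩ := exists_eq_ofRel x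
  have hV : Nat.card V = Nat.card V - 1 + 1 := (Nat.sub_add_cancel Nat.card_pos).symm
  let e : V ≃ Fin (Nat.card V - 1 + 1) := (Finite.equivFin V).trans (finCongr hV)
  refine ⟨⟨⟨Nat.card V - 1, hV.ge.trans hx⟩, fun a b => r (e.symm a) (e.symm b)⟩, ?_⟩
  exact Subtype.ext (ofRel_eq_ofRel.2 ⟨⟨e.symm, Iff.rfl⟩⟩)

theorem ofRel_join_eq_of_embeddings {α β : Type} [Finite α] [Finite β] [Nonempty (α ⊕ β)]
    {r : α → α → Prop} {t : β → β → Prop} (f : r ↪r s) (g : t ↪r s) (hd : ∀ a b, f a ≠ g b)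
    (hcard : Nat.card W ≤ Nat.card α + Nat.card β) :
    ofRel (join r (fun a b => edgeLabel s (f a) (g b)) t) = ofRel s :=
  eq_of_le_of_size_le (ofRel_le_of_embedding (joinElim f g hd fun _ _ => rfl))
    (by rwa [size_ofRel, size_ofRel, Nat.card_sum])

end Size

section Automorphism

variable {φ : DigraphType ≃o DigraphType} {x y : DigraphType}

theorem size_le_size_map (φ : DigraphType ≃o DigraphType) (x : DigraphType) :
    size x ≤ size (φ x) := by
  have lt_size_map (n : ℕ) : ∀ x, n < size x → n < size (φ x) := by
    induction n with
    | zero => exact fun x _ => size_pos _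
    | succ n ih =>
      intro x hx
      obtain ⟨y, hyx, hy⟩ := exists_lt_size_eq n.succ_pos hx
      have h : size (φ y) < size (φ x) := size_strictMono (φ.lt_iff_lt.2 hyx)
      have := ih y (by omega)
      omega
  exact le_of_forall_lt fun n => lt_size_map n x

theorem size_map (φ : DigraphType ≃o DigraphType) (x : DigraphType) : size (φ x) = size x :=
  le_antisymm (by simpa using size_le_size_map φ.symm (φ x)) (size_le_size_map φ x)

theorem isFixedPt_of_map_le (h : φ x ≤ x) : IsFixedPt φ x :=
  eq_of_le_of_size_le h (size_map φ x).ge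

theorem isFixedPt_symm (h : IsFixedPt φ x) : IsFixedPt φ.symm x :=
  φ.symm_apply_eq.2 h.symm

theorem le_map_iff_of_isFixedPt (hx : IsFixedPt φ x) : x ≤ φ y ↔ x ≤ y := by
  conv_lhs => rw [← hx.eq]
  exact φ.le_iff_le

theorem card_eq_of_map_eq {V W : Type} [Finite V] [Nonempty V] [Finite W] [Nonempty W]
    {r : V → V → Prop} {s : W → W → Prop} (h : φ (ofRel r) = ofRel s) :
    Nat.card W = Nat.card V := by
  rw [← size_ofRel (r := s), ← h, size_map, size_ofRel]

end Automorphism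

section FixesSmall

variable {φ : DigraphType ≃o DigraphType} {V W : Type} [Finite V] [Nonempty V] [Finite W]
  [Nonempty W] {r : V → V → Prop} {s : W → W → Prop} {m : ℕ}

/-- The automorphism `φ` fixes all digraphs with at most four vertices. It will turn out that the
identity is the only such automorphism. -/
def FixesSmall (φ : DigraphType ≃o DigraphType) : Prop := ∀ x, size x ≤ 4 → IsFixedPt φ x

theorem FixesSmall.symm (hφ : FixesSmall φ) : FixesSmall φ.symm :=
  fun x hx => isFixedPt_symm (hφ x hx)

theorem FixesSmall.isFixedPt_ofRel (hφ : FixesSmall φ) (hV : Nat.card V ≤ 4) :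
    IsFixedPt φ (ofRel r) :=
  hφ _ hV

theorem FixesSmall.exists_tuple (hφ : FixesSmall φ) (h : φ (ofRel r) = ofRel s) {ι : Type}
    [Finite ι] [Nonempty ι] (hι : Nat.card ι ≤ 4) (p : ι → W) :
    ∃ q : ι → V, (∀ i j, q i = q j ↔ p i = p j) ∧ ∀ i j, r (q i) (q j) ↔ s (p i) (p j) := by
  have hfix : IsFixedPt φ (ofRel (Subrel s (· ∈ Set.range p))) := hφ.isFixedPt_ofRel
    ((Nat.card_le_card_of_surjective _ Set.rangeFactorization_surjective).trans hι)
  obtain ⟨f⟩ := ofRel_le_ofRel.1 ((le_map_iff_of_isFixedPt hfix).1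
    (h ▸ ofRel_le_of_embedding (Subrel.relEmbedding s _)))
  exact ⟨fun i => f ⟨p i, i, rfl⟩, fun i j => f.injective.eq_iff.trans Subtype.ext_iff,
    fun i j => f.map_rel_iff⟩

theorem ofRel_eq_chain [IsLinearOrder W s] (hW : Nat.card W = m) [NeZero m] :
    ofRel s = ofRel fun i j : Fin m => i ≤ j := by
  classical
  let _ : LinearOrder W :=
    { le := s
      le_refl := Std.Refl.refl
      le_trans := fun _ _ _ => _root_.trans
      le_antisymm := Std.Antisymm.antisymm
      le_total := Std.Total.total
      toDecidableLE := Classical.decRel _ }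
  have := Fintype.ofFinite W
  have e := Fintype.orderIsoFinOfCardEq W (k := m) (by rwa [← Nat.card_eq_fintype_card])
  exact (ofRel_eq_ofRel.2 ⟨e⟩).symm

theorem FixesSmall.chain (hφ : FixesSmall φ) [NeZero m] :
    IsFixedPt φ (ofRel fun i j : Fin m => i ≤ j) := by
  obtain ⟨W, _, _, s, h⟩ := exists_eq_ofRel (φ (ofRel fun i j : Fin m => i ≤ j))
  have triple (a b c : W) := hφ.exists_tuple h (ι := Fin 3) (by simp) ![a, b, c]
  have : IsLinearOrder W s :=
    { refl a := by
        obtain ⟨q, -, hq⟩ := triple a a a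
        exact (hq 0 0).1 le_rfl
      trans a b c hab hbc := by
        obtain ⟨q, -, hq⟩ := triple a b c
        exact (hq 0 2).1 (((hq 0 1).2 hab).trans ((hq 1 2).2 hbc))
      antisymm a b hab hba := by
        obtain ⟨q, hq', hq⟩ := triple a b b
        exact (hq' 0 1).1 (le_antisymm ((hq 0 1).2 hab) ((hq 1 0).2 hba))
      total a b := by
        obtain ⟨q, -, hq⟩ := triple a b b
        exact (le_total (q 0) (q 1)).imp (hq 0 1).1 (hq 1 0).1 }
  exact h.trans (ofRel_eq_chain ((card_eq_of_map_eq h).trans (Nat.card_fin m)))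

end FixesSmall

section Attach

variable {φ : DigraphType ≃o DigraphType} {α F : Type} [Finite α] [Finite F]
  {r : α → α → Prop} {ρ : F → F → Prop}

theorem exists_map_join_eq (hr : ∀ a, r a a) (hρ : ∀ f, ¬ ρ f f) [Nonempty α]
    [Nonempty F] (hfr : IsFixedPt φ (ofRel r)) (hfρ : IsFixedPt φ (ofRel ρ))
    (w : α → F → Prop × Prop) :
    ∃ w' : α → F → Prop × Prop, φ (ofRel (join r w ρ)) = ofRel (join r w' ρ) := by
  obtain ⟨W, _, _, s, h⟩ := exists_eq_ofRel (φ (ofRel (join r w ρ)))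
  obtain ⟨f⟩ := ofRel_le_ofRel.1
    (h ▸ (le_map_iff_of_isFixedPt hfr).2 (ofRel_le_of_embedding (joinInl r w ρ)))
  obtain ⟨g⟩ := ofRel_le_ofRel.1
    (h ▸ (le_map_iff_of_isFixedPt hfρ).2 (ofRel_le_of_embedding (joinInr r w ρ)))
  refine ⟨_, h.trans (ofRel_join_eq_of_embeddings f g (fun a b hab => hρ b ?_) ?_).symm⟩
  · rw [← g.map_rel_iff, ← hab]
    exact f.map_rel_iff.2 (hr a)
  · rw [card_eq_of_map_eq h, Nat.card_sum]

theorem exists_joinMap_of_map_eq {β G : Type} [Finite β] [Finite G] [Nonempty α] [Nonempty β]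
    {t : β → β → Prop} {τ : G → G → Prop} {w w' : α → F → Prop × Prop} {u : β → G → Prop × Prop}
    (ht : ∀ a, t a a) (hr : ∀ a, r a a) (hτ : ∀ f, ¬ τ f f) (hρ : ∀ f, ¬ ρ f f)
    (hfix : IsFixedPt φ (ofRel (join t u τ))) (h : φ (ofRel (join r w ρ)) = ofRel (join r w' ρ))
    (γ : join t u τ ↪r join r w ρ) :
    ∃ (f : t ↪r r) (g : τ ↪r ρ), ∀ a b, u a b = w' (f a) (g b) := by
  obtain ⟨γ'⟩ := ofRel_le_ofRel.1
    (h ▸ (le_map_iff_of_isFixedPt hfix).2 (ofRel_le_of_embedding γ))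
  exact exists_joinMap_of_refl_irrefl ht hr hτ hρ γ'

theorem ofRel_join_chain_le_iff [Nonempty F] {k m : ℕ} (hl : ∀ f, ¬ ρ f f)
    (hrigid : ∀ (f : ρ ↪r ρ) (x : F), f x = x) {u : Fin k → F → Prop × Prop}
    {w : Fin m → F → Prop × Prop} :
    ofRel (join (· ≤ ·) u ρ) ≤ ofRel (join (· ≤ ·) w ρ) ↔ ∃ g : Fin k ↪o Fin m, u = w ∘ g := by
  rw [ofRel_le_ofRel]
  constructor
  · rintro ⟨γ⟩
    obtain ⟨g, p, h⟩ := exists_joinMap_of_refl_irrefl (fun _ => le_rfl) (fun _ => le_rfl) hl hl γ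
    exact ⟨g, funext fun i => funext fun f => by rw [h, hrigid, comp_apply]⟩
  · rintro ⟨g, rfl⟩
    exact ⟨joinMap g (.refl ρ) fun _ _ => rfl⟩

theorem FixesSmall.join_chain_rigid [Nonempty F] (hφ : FixesSmall φ) (hl : ∀ f, ¬ ρ f f)
    (hrigid : ∀ (f : ρ ↪r ρ) (x : F), f x = x) (hF : Nat.card F ≤ 2) {m : ℕ}
    (w : Fin m → F → Prop × Prop) : IsFixedPt φ (ofRel (join (· ≤ ·) w ρ)) := by
  induction m with
  | zero => exact hφ.isFixedPt_ofRel (by rw [Nat.card_sum, Nat.card_fin]; omega)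
  | succ m ih =>
    obtain hm | hm := Nat.lt_or_ge m 2
    · exact hφ.isFixedPt_ofRel (by rw [Nat.card_sum, Nat.card_fin]; omega)
    obtain ⟨w', h⟩ := exists_map_join_eq (fun _ => le_rfl) hl hφ.chain
      (hφ.isFixedPt_ofRel (hF.trans (by decide))) w
    obtain rfl : w = w' := eq_of_exists_comp_eq_iff hm fun u => by
      rw [← ofRel_join_chain_le_iff hl hrigid, ← ofRel_join_chain_le_iff hl hrigid, ← h,
        le_map_iff_of_isFixedPt (ih u)]
    exact h

theorem rigid_or_invariant_of_card_le_two (hl : ∀ f, ¬ ρ f f) (hF : Nat.card F ≤ 2) :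
    (∀ (f : ρ ↪r ρ) (x : F), f x = x) ∨
      ∀ σ : F ↪ F, ∀ a b, ρ (σ a) (σ b) ↔ ρ a b := by
  have := Fintype.ofFinite F
  have two {a b : F} (hab : a ≠ b) (c : F) : c = a ∨ c = b := by
    by_contra! h
    rw [Nat.card_eq_fintype_card] at hF
    exact hF.not_gt (Fintype.two_lt_card_iff.2 ⟨a, b, c, hab, h.1.symm, h.2.symm⟩)
  by_cases hs : ∀ a b, ρ a b → ρ b a
  · refine .inr fun σ a b => ?_
    obtain rfl | hab := eq_or_ne a b
    · exact iff_of_false (hl _) (hl _)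
    · have hne := σ.injective.ne hab
      have hσa := two hab (σ a)
      have hσb := two hab (σ b)
      grind
  · push Not at hs
    obtain ⟨a, b, hab, hba⟩ := hs
    refine .inl fun f x => ?_
    have hne : a ≠ b := by
      rintro rfl
      exact hba hab
    have hfne := f.injective.ne hne
    have hf := f.map_rel_iff (a := a) (b := b)
    have hfa := two hne (f a)
    have hfb := two hne (f b)
    have hx := two hne x
    grind

theorem FixesSmall.exists_column_eq (hφ : FixesSmall φ) (hl : ∀ f, ¬ ρ f f) {m : ℕ}
    [NeZero m] {w w' : Fin m → F → Prop × Prop}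
    (h : φ (ofRel (join (· ≤ ·) w ρ)) = ofRel (join (· ≤ ·) w' ρ)) (f : F) :
    ∃ f', ∀ i, w i f = w' i f' := by
  have hfix : IsFixedPt φ (ofRel (join (· ≤ ·) (fun i (_ : Unit) => w i f) fun _ _ => ρ f f)) :=
    hφ.join_chain_rigid (fun _ => hl f) (fun _ _ => rfl) (by simp) _
  obtain ⟨g, p, hw⟩ := exists_joinMap_of_map_eq (fun _ => le_rfl) (fun _ => le_rfl)
    (fun _ => hl f) hl hfix h (joinMap (.refl _) (unitEmbedding ρ f) fun _ _ => rfl)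
  exact ⟨p (), fun i => by rw [hw i (), orderEmbedding_self_apply]⟩

theorem ofRel_join_of_isEmpty [Nonempty α] [IsEmpty F] (w : α → F → Prop × Prop) :
    ofRel (join r w ρ) = ofRel r :=
  (eq_of_le_of_size_le (ofRel_le_of_embedding (joinInl r w ρ)) (by simp [size_ofRel])).symm

theorem FixesSmall.join_chain_loopless (hφ : FixesSmall φ) (hl : ∀ f, ¬ ρ f f)
    (hF : Nat.card F ≤ 2) {m : ℕ} [NeZero m] {w : Fin m → F → Prop × Prop}
    (hinj : ∀ f g, (∀ i, w i f = w i g) → f = g) :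
    IsFixedPt φ (ofRel (join (· ≤ ·) w ρ)) := by
  cases isEmpty_or_nonempty F
  · rw [ofRel_join_of_isEmpty]
    exact hφ.chain
  obtain hrigid | hinv := rigid_or_invariant_of_card_le_two hl hF
  · exact hφ.join_chain_rigid hl hrigid hF w
  obtain ⟨w', h⟩ := exists_map_join_eq (fun _ => le_rfl) hl hφ.chain
    (hφ.isFixedPt_ofRel (hF.trans (by decide))) w
  choose σ hσ using hφ.exists_column_eq hl h
  have hσinj : Injective σ := fun f g hfg => hinj f g fun i => by rw [hσ, hσ, hfg]
  let γ : ρ ↪r ρ := ⟨⟨σ, hσinj⟩, fun {a b} => hinv ⟨σ, hσinj⟩ a b⟩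
  exact h.trans (eq_of_le_of_size_le (ofRel_le_of_embedding (joinMap (.refl _) γ
    fun i f => hσ f i)) le_rfl).symm

end Attach

section Pairs

variable {φ : DigraphType ≃o DigraphType} {α F : Type} [Finite α] [Nonempty α] [Finite F]
  {r : α → α → Prop} {ρ : F → F → Prop} {w : α → F → Prop × Prop}

theorem exists_eq_ofRel_join_of_le (huniq : ∀ (γ : r ↪r join r w ρ) (a : α), γ a = .inl a)
    {y : DigraphType} (hry : ofRel r ≤ y) (hy : y ≤ ofRel (join r w ρ)) :
    ∃ P : Set F, y = ofRel (join r (fun a (f : P) => w a f) (Subrel ρ (· ∈ P))) := by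
  obtain ⟨U, _, _, q, rfl⟩ := exists_eq_ofRel y
  obtain ⟨c⟩ := ofRel_le_ofRel.1 hry
  obtain ⟨γ⟩ := ofRel_le_ofRel.1 hy
  have hγ : ∀ a, γ (c a) = .inl a := huniq (c.trans γ)
  let P : Set F := {f | .inr f ∈ Set.range γ}
  let ι : join r (fun a (f : P) => w a f) (Subrel ρ (· ∈ P)) ↪r join r w ρ :=
    joinMap (.refl r) (Subrel.relEmbedding ρ _) fun _ _ => rfl
  refine ⟨P, le_antisymm (ofRel_le_of_range_subset γ ι ?_) (ofRel_le_of_range_subset ι γ ?_)⟩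
  · rintro _ ⟨x, rfl⟩
    rcases hx : γ x with a | f
    exacts [⟨.inl a, rfl⟩, ⟨.inr ⟨f, x, hx⟩, rfl⟩]
  · rintro _ ⟨a | ⟨f, hf⟩, rfl⟩
    exacts [⟨c a, hγ a⟩, hf]

/-- The part of `φ (join r w ρ)` spanned by `r` and `T` is fixed, because its preimage contains `r`
and is thus a join of `r` with a part of `ρ`. -/
theorem exists_embedding_of_ncard_le (hr : IsFixedPt φ (ofRel r))
    (huniq : ∀ (γ : r ↪r join r w ρ) (a : α), γ a = .inl a) {k : ℕ}
    (hfix : ∀ P : Set F, P.ncard ≤ k →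
      IsFixedPt φ (ofRel (join r (fun a (f : P) => w a f) (Subrel ρ (· ∈ P)))))
    {W : Type} [Finite W] [Nonempty W] {s : W → W → Prop} (h : φ (ofRel (join r w ρ)) = ofRel s)
    (e : r ↪r s) {T : Set W} (hT : T.ncard ≤ k) (he : ∀ a, e a ∉ T) :
    ∃ g : Subrel s (· ∈ T) ↪r ρ, ∀ a z, w a (g z) = edgeLabel s (e a) z := by
  let q := join r (fun a (z : T) => edgeLabel s (e a) z) (Subrel s (· ∈ T))
  have hq : φ.symm (ofRel q) ≤ ofRel (join r w ρ) := by
    rw [φ.symm_apply_le, h]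
    exact ofRel_le_of_embedding (joinElim e (Subrel.relEmbedding s _)
      (fun a z haz => he a (haz ▸ z.2)) fun _ _ => rfl)
  obtain ⟨P, hP⟩ := exists_eq_ofRel_join_of_le huniq
    ((le_map_iff_of_isFixedPt (isFixedPt_symm hr)).2 (ofRel_le_of_embedding (joinInl r _ _))) hq
  have hcard : P.ncard = T.ncard := by
    have := (congrArg size hP).symm
    rw [size_map] at this
    simpa [size_ofRel] using this
  have hfixq : IsFixedPt φ (φ.symm (ofRel q)) := hP ▸ hfix P (hcard.trans_le hT)
  rw [← hfixq.eq, φ.apply_symm_apply] at hq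
  obtain ⟨κ⟩ := ofRel_le_ofRel.1 hq
  exact exists_embedding_of_map_inl κ (huniq ((joinInl r _ _).trans κ))

theorem isFixedPt_join_of_pairs (hr : IsFixedPt φ (ofRel r))
    (huniq : ∀ (γ : r ↪r join r w ρ) (a : α), γ a = .inl a)
    (hinj : ∀ f g, (∀ a, w a f = w a g) → (ρ f f ↔ ρ g g) → f = g)
    (hfix : ∀ P : Set F, P.ncard ≤ 2 →
      IsFixedPt φ (ofRel (join r (fun a (f : P) => w a f) (Subrel ρ (· ∈ P))))) :
    IsFixedPt φ (ofRel (join r w ρ)) := by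
  obtain ⟨W, _, _, s, h⟩ := exists_eq_ofRel (φ (ofRel (join r w ρ)))
  obtain ⟨e⟩ := ofRel_le_ofRel.1
    (h ▸ (le_map_iff_of_isFixedPt hr).2 (ofRel_le_of_embedding (joinInl r w ρ)))
  have pair (z z' : ((Set.range e)ᶜ : Set W)) :
      ∃ g : Subrel s (· ∈ ({z.1, z'.1} : Set W)) ↪r ρ, ∀ a x, w a (g x) = edgeLabel s (e a) x :=
    exists_embedding_of_ncard_le hr huniq hfix h e ((Set.ncard_insert_le _ _).trans
      (by rw [Set.ncard_singleton])) (by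
      rintro a (ha | ha)
      exacts [z.2 ⟨a, ha⟩, z'.2 ⟨a, ha⟩])
  have single (z : ((Set.range e)ᶜ : Set W)) :
      ∃ f, (ρ f f ↔ s z z) ∧ ∀ a, w a f = edgeLabel s (e a) z := by
    obtain ⟨g, hg⟩ := pair z z
    exact ⟨g ⟨z, .inl rfl⟩, g.map_rel_iff, fun a => hg a _⟩
  choose β hβ hβw using single
  have hpair (z z' : ((Set.range e)ᶜ : Set W)) :
      (β z = β z' → z = z') ∧ (ρ (β z) (β z') ↔ s z z') := by
    obtain ⟨g, hg⟩ := pair z z'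
    have hgβ (x : ((Set.range e)ᶜ : Set W)) (hx : x.1 ∈ ({z.1, z'.1} : Set W)) : g ⟨x, hx⟩ = β x :=
      hinj _ _ (fun a => by rw [hg, hβw]) (g.map_rel_iff.trans (hβ x).symm)
    rw [← hgβ z (.inl rfl), ← hgβ z' (.inr rfl)]
    exact ⟨fun hzz => Subtype.ext (congrArg (fun x => x.1) (g.injective hzz)), g.map_rel_iff⟩
  let γ : Subrel s (· ∈ (Set.range e)ᶜ) ↪r ρ :=
    ⟨⟨β, fun z z' => (hpair z z').1⟩, fun {z z'} => (hpair z z').2⟩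
  have hcard : Nat.card W ≤ Nat.card α + Nat.card ((Set.range e)ᶜ : Set W) := by
    rw [← Set.ncard_add_ncard_compl (Set.range e), Set.ncard_range_of_injective e.injective,
      Nat.card_coe_set_eq]
  refine isFixedPt_of_map_le ?_
  rw [h, ← ofRel_join_eq_of_embeddings e (Subrel.relEmbedding s (· ∈ (Set.range e)ᶜ))
    (fun a z haz => z.2 ⟨a, haz⟩) hcard]
  exact ofRel_le_of_embedding (joinMap (.refl r) γ fun a z => (hβw z a).symm)

end Pairs

section Loopless

variable {φ : DigraphType ≃o DigraphType} {F : Type} {ρ : F → F → Prop} {m : ℕ}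
  {w : Fin m → F → Prop × Prop}

theorem chain_embedding_eq_inl (γ : (fun i j : Fin m => i ≤ j) ↪r join (· ≤ ·) w ρ)
    (h : ∀ i, ∃ j, γ i = .inl j) (i : Fin m) : γ i = .inl i := by
  choose f hf using h
  let f' : Fin m ↪o Fin m := ⟨⟨f, fun i j hij => γ.injective (by rw [hf, hf, hij])⟩, fun {i j} => by
    have := γ.map_rel_iff (a := i) (b := j)
    rwa [hf, hf] at this⟩
  exact (hf i).trans (congrArg _ (orderEmbedding_self_apply f' i))

/-- A vertex outside the chain that is related symmetrically to the chain vertices cannot belong to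
a chain together with any of them. -/
theorem exists_eq_inl_of_chain_embedding [Finite F] {k : ℕ}
    (hw : ∀ f, ρ f f → ∀ i, (w i f).1 ↔ (w i f).2) (hcard : Nat.card {f // ρ f f} < k)
    (γ : (fun i j : Fin k => i ≤ j) ↪r join (· ≤ ·) w ρ) (i : Fin k) : ∃ j, γ i = .inl j := by
  have hloop {i : Fin k} {f : F} (hf : γ i = .inr f) : ρ f f := by
    have := (γ.map_rel_iff (a := i) (b := i)).2 le_rfl
    rwa [hf] at this
  rcases hi : γ i with j | f
  · exact ⟨j, rfl⟩
  have hall (l : Fin k) : ∃ g : {f // ρ f f}, γ l = .inr g.1 := by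
    rcases hl : γ l with j | g
    · have hli := γ.map_rel_iff (a := l) (b := i)
      have hil := γ.map_rel_iff (a := i) (b := l)
      rw [hi, hl] at hli hil
      obtain rfl : l = i := eq_of_le_iff_le (hli.symm.trans ((hw f (hloop hi) j).trans hil))
      exact absurd (hl.symm.trans hi) Sum.inl_ne_inr
    · exact ⟨⟨g, hloop hl⟩, rfl⟩
  choose g hg using hall
  have hk := Nat.card_le_card_of_injective g fun i j hij => γ.injective (by rw [hg, hg, hij])
  rw [Nat.card_fin] at hk
  exact absurd hcard hk.not_gt

theorem chain_embedding_eq_inl_of_card_lt [Finite F]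
    (hw : ∀ f, ρ f f → ∀ i, (w i f).1 ↔ (w i f).2) (hcard : Nat.card {f // ρ f f} < m)
    (γ : (fun i j : Fin m => i ≤ j) ↪r join (· ≤ ·) w ρ) (i : Fin m) : γ i = .inl i :=
  chain_embedding_eq_inl γ (exists_eq_inl_of_chain_embedding hw hcard γ) i

theorem FixesSmall.isFixedPt_loopless (hφ : FixesSmall φ) [Finite F] [Nonempty F]
    (hl : ∀ f, ¬ ρ f f) : IsFixedPt φ (ofRel ρ) := by
  have : NeZero (Nat.card F) := ⟨Nat.card_pos.ne'⟩
  let e := Finite.equivFin F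
  let w : Fin (Nat.card F) → F → Prop × Prop := fun i f => (i = e f, False)
  have hw (f g : F) (hfg : ∀ i, w i f = w i g) : f = g :=
    e.injective (((Prod.ext_iff.1 (hfg (e f))).1).mp rfl)
  have hfix : IsFixedPt φ (ofRel (join (· ≤ ·) w ρ)) :=
    isFixedPt_join_of_pairs hφ.chain (fun γ => chain_embedding_eq_inl γ fun i =>
      exists_eq_inl_of_join_self hl (γ.map_rel_iff.2 le_rfl))
      (fun f g hfg _ => hw f g hfg) fun P hP =>
        hφ.join_chain_loopless (F := P) (fun _ => hl _) hP fun f g hfg => Subtype.ext (hw f g hfg)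
  obtain ⟨W, _, _, s, h⟩ := exists_eq_ofRel (φ (ofRel ρ))
  have hs (z : W) : ¬ s z z := by
    obtain ⟨q, -, hq⟩ := hφ.exists_tuple h (ι := Unit) (by simp) fun _ => z
    exact mt (hq () ()).2 (hl _)
  have hle : ofRel s ≤ ofRel (join (· ≤ ·) w ρ) := by
    rw [← h, ← hfix.eq, φ.le_iff_le]
    exact ofRel_le_of_embedding (joinInr _ w ρ)
  obtain ⟨γ⟩ := ofRel_le_ofRel.1 hle
  refine isFixedPt_of_map_le (h ▸ ofRel_le_of_range_subset γ (joinInr _ w ρ) ?_)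
  rintro _ ⟨z, rfl⟩
  obtain ⟨f, hf, -⟩ := exists_eq_inr_of_not_join_self (fun _ => le_rfl) (mt γ.map_rel_iff.1 (hs z))
  exact ⟨f, hf.symm⟩

end Loopless

section LoopComplement

/-- The relation that differs from `r` in that the elements related to themselves are interchanged
with those that are not. -/
def loopCompl {α : Type*} (r : α → α → Prop) (a b : α) : Prop := Xor (a = b) (r a b)

@[simp] theorem loopCompl_self {α : Type*} {r : α → α → Prop} {a : α} :
    loopCompl r a a ↔ ¬ r a a := by
  simp [loopCompl, xor_def]

theorem loopCompl_loopCompl {α : Type*} (r : α → α → Prop) : loopCompl (loopCompl r) = r := by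
  ext a b
  simp only [loopCompl, xor_def]
  tauto

/-- An embedding is also one for the relations with complemented loops. -/
def loopComplEmbedding {α β : Type*} {r : α → α → Prop} {s : β → β → Prop} (f : r ↪r s) :
    loopCompl r ↪r loopCompl s :=
  ⟨f.toEmbedding, fun {a b} => by
    rw [loopCompl, loopCompl, ← f.map_rel_iff, RelEmbedding.coe_toEmbedding, f.injective.eq_iff]⟩

variable {φ : DigraphType ≃o DigraphType} {V : Type} [Finite V] [Nonempty V] {r : V → V → Prop}

/-- Complementation of the loops as a map on isomorphism types. -/
def complLoops : DigraphType → DigraphType :=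
  Quotient.map (fun G => { V := G.V, graph := ⟨loopCompl G.graph.Adj⟩ }) fun _ _ ⟨e⟩ =>
    ⟨⟨e.toEquiv, (loopComplEmbedding e.toRelEmbedding).map_rel_iff⟩⟩

theorem complLoops_ofRel : complLoops (ofRel r) = ofRel (loopCompl r) := rfl

theorem complLoops_involutive : Involutive complLoops := fun x => by
  obtain ⟨V, _, _, r, rfl⟩ := exists_eq_ofRel x
  rw [complLoops_ofRel, complLoops_ofRel, loopCompl_loopCompl]

theorem complLoops_monotone : Monotone complLoops := fun x y h => by
  obtain ⟨V, _, _, r, rfl⟩ := exists_eq_ofRel x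
  obtain ⟨W, _, _, s, rfl⟩ := exists_eq_ofRel y
  exact ofRel_le_ofRel.2 ((ofRel_le_ofRel.1 h).map loopComplEmbedding)

/-- Complementation of the loops as an automorphism of the poset of digraphs. -/
def complLoopsIso : DigraphType ≃o DigraphType where
  toEquiv := complLoops_involutive.toPerm
  map_rel_iff' {x y} := ⟨fun h => by
    simpa only [complLoops_involutive.coe_toPerm, complLoops_involutive _] using
      complLoops_monotone h, fun h => complLoops_monotone h⟩

theorem complLoopsIso_apply (x : DigraphType) : complLoopsIso x = complLoops x := rfl

theorem FixesSmall.conj_complLoopsIso (hφ : FixesSmall φ) :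
    FixesSmall (complLoopsIso.trans (φ.trans complLoopsIso)) := fun x hx => by
  rw [IsFixedPt, OrderIso.trans_apply, OrderIso.trans_apply, (hφ _ (by rwa [size_map])).eq]
  exact complLoops_involutive x

theorem isFixedPt_of_conj_complLoopsIso
    (h : IsFixedPt (complLoopsIso.trans (φ.trans complLoopsIso)) (ofRel (loopCompl r))) :
    IsFixedPt φ (ofRel r) := by
  rw [IsFixedPt, ← complLoops_ofRel, OrderIso.trans_apply, OrderIso.trans_apply,
    complLoopsIso_apply, complLoopsIso_apply, complLoops_involutive (ofRel r)] at h
  exact complLoops_involutive.injective h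

theorem FixesSmall.isFixedPt_looped (hφ : FixesSmall φ) (hr : ∀ v, r v v) :
    IsFixedPt φ (ofRel r) :=
  isFixedPt_of_conj_complLoopsIso
    (hφ.conj_complLoopsIso.isFixedPt_loopless fun v => by rw [loopCompl_self, not_not]; exact hr v)

end LoopComplement

section MixedPair

variable {φ : DigraphType ≃o DigraphType} {m : ℕ}

theorem FixesSmall.join_join_unit (hφ : FixesSmall φ) (hm : 2 ≤ m) {σ τ : Unit → Unit → Prop}
    (hσ : σ () ()) (hτ : ¬ τ () ()) {v : Fin m → Unit → Prop × Prop}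
    (hv : ∀ i, (v i ()).1 ↔ (v i ()).2) (u : Fin m ⊕ Unit → Unit → Prop × Prop) :
    IsFixedPt φ (ofRel (join (join (· ≤ ·) v σ) u τ)) := by
  have : NeZero m := ⟨by omega⟩
  have hrefl {k : ℕ} (v : Fin k → Unit → Prop × Prop) : ∀ x, join (· ≤ ·) v σ x x := by
    rintro (i | _)
    exacts [le_refl i, hσ]
  have hcard : Nat.card {f // σ f f} < 2 := (Finite.card_subtype_le _).trans_lt (by simp)
  obtain ⟨u', h⟩ := exists_map_join_eq (hrefl v) (fun _ => hτ) (hφ.isFixedPt_looped (hrefl v))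
    (hφ.isFixedPt_ofRel (r := τ) (by simp)) u
  have hchain (i : Fin m) : u (.inl i) () = u' (.inl i) () := by
    obtain ⟨f, g, hfg⟩ := exists_joinMap_of_map_eq (fun _ => le_rfl) (hrefl v) (fun _ => hτ)
      (fun _ => hτ)
      (hφ.join_chain_rigid (ρ := τ) (fun _ => hτ) (fun _ _ => rfl) (by simp) fun i => u (.inl i)) h
      (joinMap (joinInl (· ≤ ·) v σ) (.refl τ) fun _ _ => rfl)
    rw [hfg, chain_embedding_eq_inl_of_card_lt (fun _ _ => hv) (hcard.trans_le hm)]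
  have hpoint : u (.inr ()) () = u' (.inr ()) () := by
    let c : Fin 2 ↪o Fin m := Fin.castLEOrderEmb hm
    let γ : join (· ≤ ·) (v ∘ c) σ ↪r join (· ≤ ·) v σ := joinMap c (.refl σ) fun _ _ => rfl
    obtain ⟨f, g, hfg⟩ := exists_joinMap_of_map_eq (hrefl _) (hrefl v) (fun _ => hτ) (fun _ => hτ)
      (hφ.isFixedPt_ofRel (r := join _ (u ∘ γ) τ) (by simp)) h
      (joinMap γ (.refl τ) fun _ _ => rfl)
    obtain ⟨a, ha⟩ := exists_eq_inl_of_chain_embedding (fun _ _ => hv) hcard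
      ((joinInl _ _ _).trans f) 0
    rcases hf : f (.inr ()) with j | _
    · have h0 := f.map_rel_iff (a := .inl 0) (b := .inr ())
      have h1 := f.map_rel_iff (a := .inr ()) (b := .inl 0)
      rw [RelEmbedding.trans_apply, joinInl_apply] at ha
      rw [ha, hf] at h0 h1
      obtain rfl : a = j := eq_of_le_iff_le (h0.trans ((hv _).trans h1.symm))
      exact absurd (f.injective (ha.trans hf.symm)) Sum.inl_ne_inr
    · exact (hfg (.inr ()) ()).trans (by rw [hf])
  obtain rfl : u = u' := by
    ext x _ : 2
    rcases x with i | _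
    exacts [hchain i, hpoint]
  exact h

theorem FixesSmall.join_chain_mixed [NeZero m] (hφ : FixesSmall φ) (hm : 2 ≤ m) {F : Type}
    [Finite F] {w : Fin m → F → Prop × Prop} {ρ : F → F → Prop} {x y : F} (hxy : ∀ f, f = x ∨ f = y)
    (hx : ¬ ρ x x) (hy : ρ y y) (hw : ∀ i, (w i y).1 ↔ (w i y).2) :
    IsFixedPt φ (ofRel (join (· ≤ ·) w ρ)) := by
  let κ : join (· ≤ ·) (fun i _ => w i y) (fun _ _ : Unit => ρ y y) ↪r join (· ≤ ·) w ρ :=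
    joinMap (.refl _) (unitEmbedding ρ y) fun _ _ => rfl
  let ζ : (fun _ _ : Unit => ρ x x) ↪r join (· ≤ ·) w ρ :=
    (unitEmbedding ρ x).trans (joinInr _ w ρ)
  have hd : ∀ a b, κ a ≠ ζ b := by
    rintro (i | _) _
    · exact Sum.inl_ne_inr
    · intro h
      have hyx : y = x := Sum.inr_injective h
      exact hx (hyx ▸ hy)
  have hF : Nat.card F ≤ 2 := by
    have : Surjective ![x, y] := fun f => (hxy f).elim (fun h => ⟨0, h.symm⟩) fun h => ⟨1, h.symm⟩
    simpa using Nat.card_le_card_of_surjective _ this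
  rw [← ofRel_join_eq_of_embeddings κ ζ hd (by simpa [add_assoc] using hF)]
  exact hφ.join_join_unit hm hy hx hw _

end MixedPair

section Chain

variable {φ : DigraphType ≃o DigraphType} {F : Type} [Finite F] {ρ : F → F → Prop}

theorem FixesSmall.isFixedPt_join_chain (hφ : FixesSmall φ) {m : ℕ} [NeZero m] (hm : 2 ≤ m)
    {w : Fin m → F → Prop × Prop} (hcard : Nat.card {f // ρ f f} < m)
    (hw : ∀ f, ρ f f → ∀ i, (w i f).1 ↔ (w i f).2)
    (hinj : ∀ f g, (∀ i, w i f = w i g) → (ρ f f ↔ ρ g g) → f = g) :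
    IsFixedPt φ (ofRel (join (· ≤ ·) w ρ)) := by
  refine isFixedPt_join_of_pairs hφ.chain (chain_embedding_eq_inl_of_card_lt hw hcard) hinj
    fun P hP => ?_
  have hP' : Nat.card P ≤ 2 := hP
  by_cases hlooped : ∀ f : P, ρ f f
  · refine hφ.isFixedPt_looped ?_
    rintro (i | f)
    exacts [le_refl i, hlooped f]
  by_cases hloopless : ∀ f : P, ¬ ρ f f
  · exact hφ.join_chain_loopless (ρ := Subrel ρ (· ∈ P)) hloopless hP' fun f g hfg =>
      Subtype.ext (hinj f g hfg (iff_of_false (hloopless f) (hloopless g)))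
  push Not at hlooped hloopless
  obtain ⟨x, hx⟩ := hlooped
  obtain ⟨y, hy⟩ := hloopless
  have hxy : x ≠ y := fun h => hx (h ▸ hy)
  refine hφ.join_chain_mixed hm (x := x) (y := y) (fun f => ?_) hx hy (hw y hy)
  by_contra! hf
  have := Fintype.ofFinite P
  rw [Nat.card_eq_fintype_card] at hP'
  exact hP'.not_gt (Fintype.two_lt_card_iff.2 ⟨x, y, f, hxy, hf.1.symm, hf.2.symm⟩)

/-- The chain vertices realize all permutations of `v` on the loopless vertices, and each looped
vertex is adjacent to one chain vertex only, so that the chain tells all vertices apart. -/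
theorem FixesSmall.exists_join_chain_perm [Nonempty F] (hφ : FixesSmall φ)
    {v : {f // ¬ ρ f f} → Prop × Prop} {x y : {f // ¬ ρ f f}} (hxy : v x ≠ v y) :
    ∃ (m : ℕ) (w : Fin m → F → Prop × Prop), IsFixedPt φ (ofRel (join (· ≤ ·) w ρ)) ∧
      ∀ i, ∃ σ : Equiv.Perm {f // ¬ ρ f f}, ∀ a : {f // ¬ ρ f f}, w i a = v (σ a) := by
  classical
  let e := Finite.equivFin (Equiv.Perm {f // ¬ ρ f f} × F)
  let ι (f : F) : Fin (Nat.card (Equiv.Perm {f // ¬ ρ f f} × F)) := e (1, f)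
  have hι : Injective ι := e.injective.comp (Prod.mk_right_injective 1)
  let w (i : Fin (Nat.card (Equiv.Perm {f // ¬ ρ f f} × F))) (f : F) : Prop × Prop :=
    if h : ρ f f then (i = ι f, i = ι f) else v ((e.symm i).1 ⟨f, h⟩)
  have hw_looped {f : F} (hf : ρ f f) (i) : w i f = (i = ι f, i = ι f) := dif_pos hf
  have hw_loopless (a : {f // ¬ ρ f f}) (i) : w i a = v ((e.symm i).1 a) := dif_neg a.2
  have hF : Nat.card F ≤ Nat.card (Equiv.Perm {f // ¬ ρ f f} × F) := by
    simpa using Nat.card_le_card_of_injective ι hι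
  have : Nontrivial F := ⟨x, y, fun h => hxy (congrArg v (Subtype.ext h))⟩
  have : NeZero (Nat.card (Equiv.Perm {f // ¬ ρ f f} × F)) := ⟨Nat.card_pos.ne'⟩
  refine ⟨_, w, hφ.isFixedPt_join_chain (Finite.one_lt_card.trans_le hF)
    ((Finite.card_subtype_lt (p := fun f => ρ f f) x.2).trans_le hF) (fun f hf i => ?_)
    (fun f g hfg hloop => ?_), fun i => ⟨(e.symm i).1, fun a => hw_loopless a i⟩⟩
  · rw [hw_looped hf]
  by_cases hf : ρ f f
  · have h := hfg (ι f)
    rw [hw_looped hf, hw_looped (hloop.1 hf)] at h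
    exact hι ((Prod.ext_iff.1 h).1.mp rfl)
  · by_contra hne
    let a : {f // ¬ ρ f f} := ⟨f, hf⟩
    let b : {f // ¬ ρ f f} := ⟨g, mt hloop.2 hf⟩
    have hab : a ≠ b := fun h => hne (congrArg Subtype.val h)
    obtain ⟨σ, hσf, hσg⟩ := MulAction.is_two_pretransitive_iff.1
      (Equiv.Perm.isMultiplyPretransitive {f // ¬ ρ f f} 2) hab fun h => hxy (congrArg v h)
    have h := hfg (e (σ, f))
    rw [hw_loopless a, hw_loopless b, e.symm_apply_apply] at h
    rw [Equiv.Perm.smul_def] at hσf hσg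
    exact hxy (hσf ▸ hσg ▸ h)

end Chain

section Apex

variable {φ : DigraphType ≃o DigraphType} {F : Type} [Finite F] {ρ : F → F → Prop}

theorem FixesSmall.exists_map_cone_eq [Nonempty F] (hφ : FixesSmall φ) (hl : ∀ f, ¬ ρ f f)
    (v : F → Prop × Prop) :
    ∃ v', φ (ofRel (join (fun _ _ : Unit => True) (fun _ => v) ρ)) =
      ofRel (join (fun _ _ : Unit => True) (fun _ => v') ρ) := by
  obtain ⟨w, h⟩ := exists_map_join_eq (fun _ => trivial) hl
    (hφ.isFixedPt_ofRel (r := fun _ _ : Unit => True) (by simp)) (hφ.isFixedPt_loopless hl)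
    fun _ => v
  exact ⟨w (), h⟩

theorem FixesSmall.cone_const [Nonempty F] (hφ : FixesSmall φ) (hl : ∀ f, ¬ ρ f f)
    (c : Prop × Prop) :
    IsFixedPt φ (ofRel (join (fun _ _ : Unit => True) (fun _ _ => c) ρ)) := by
  obtain ⟨v, h⟩ := hφ.exists_map_cone_eq hl fun _ => c
  have h' := φ.symm_apply_eq.2 h.symm
  have hv (f : F) : v f = c := by
    obtain ⟨-, _, hg⟩ := exists_joinMap_of_map_eq (fun _ => trivial) (fun _ => trivial)
      (fun _ => hl f) hl (hφ.symm.isFixedPt_ofRel (by simp)) h'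
      (joinMap (w := fun _ _ => v f) (.refl _) (unitEmbedding ρ f) fun _ _ => rfl)
    exact hg () ()
  rwa [funext hv] at h

theorem FixesSmall.ncard_fiber_le (hφ : FixesSmall φ) (hl : ∀ f, ¬ ρ f f)
    {v v' : F → Prop × Prop}
    (h : φ (ofRel (join (fun _ _ : Unit => True) (fun _ => v) ρ)) =
      ofRel (join (fun _ _ : Unit => True) (fun _ => v') ρ)) (c : Prop × Prop) :
    (v ⁻¹' {c}).ncard ≤ (v' ⁻¹' {c}).ncard := by
  obtain hc | hc := (v ⁻¹' {c}).eq_empty_or_nonempty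
  · simp [hc]
  have := hc.to_subtype
  obtain ⟨-, g, hg⟩ := exists_joinMap_of_map_eq (fun _ => trivial) (fun _ => trivial)
    (τ := Subrel ρ (· ∈ v ⁻¹' {c})) (fun f => hl f) hl
    (hφ.cone_const (F := ↥(v ⁻¹' {c})) (fun f => hl f) c) h
    (joinMap (.refl _) (Subrel.relEmbedding ρ (· ∈ v ⁻¹' {c})) fun _ f => f.2.symm)
  exact Nat.card_le_card_of_injective (fun f => (⟨g f, (hg () f).symm⟩ : (v' ⁻¹' {c} : Set F)))
    fun f f' hff' => g.injective (congrArg Subtype.val hff')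

theorem FixesSmall.exists_apex [Nonempty F] [Nonempty {f // ¬ ρ f f}] (hφ : FixesSmall φ)
    {v : {f // ¬ ρ f f} → Prop × Prop}
    (h : ofRel (join (fun _ _ : Unit => True) (fun _ => v) (looplessPart ρ)) ≤ φ (ofRel ρ)) :
    ∃ b, ρ b b ∧ ∀ c, (v ⁻¹' {c}).ncard ≤ {a : {f // ¬ ρ f f} | edgeLabel ρ b a = c}.ncard := by
  obtain ⟨v', hv'⟩ := hφ.symm.exists_map_cone_eq (ρ := looplessPart ρ) (fun a => a.2) v
  rw [← φ.symm_apply_le, hv'] at h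
  obtain ⟨γ⟩ := ofRel_le_ofRel.1 h
  let g (a : {f // ¬ ρ f f}) : {f // ¬ ρ f f} := ⟨γ (.inr a), mt γ.map_rel_iff.1 a.2⟩
  have hg : Injective g := fun a a' h => Sum.inr_injective (γ.injective (congrArg Subtype.val h))
  refine ⟨γ (.inl ()), γ.map_rel_iff.2 trivial, fun c =>
    (hφ.symm.ncard_fiber_le (fun a => a.2) hv' c).trans
      (Set.ncard_le_ncard_of_injOn g (fun a ha => ?_) hg.injOn)⟩
  exact (edgeLabel_map γ (.inl ()) (.inr a)).trans ha

end Apex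

section Fixed

variable {φ : DigraphType ≃o DigraphType} {F : Type} [Finite F] {ρ : F → F → Prop}

theorem exists_eq_inr_of_looplessPart {W : Type} {s : W → W → Prop} {m : ℕ}
    {w : Fin m → F → Prop × Prop} (γ : s ↪r join (· ≤ ·) w ρ) (α : looplessPart ρ ↪r s)
    (a : {f // ¬ ρ f f}) : ∃ z, γ z = .inr a.1 := by
  have hloopless (a : {f // ¬ ρ f f}) : ∃ b : {f // ¬ ρ f f}, γ (α a) = .inr b.1 := by
    obtain ⟨b, hb, hbb⟩ := exists_eq_inr_of_not_join_self (fun _ => le_rfl)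
      (mt (γ.map_rel_iff.trans α.map_rel_iff).1 a.2)
    exact ⟨⟨b, hbb⟩, hb⟩
  choose β hβ using hloopless
  have hβinj : Injective β := fun a b hab =>
    α.injective (γ.injective (by rw [hβ, hβ, hab]))
  obtain ⟨b, rfl⟩ := Finite.injective_iff_surjective.1 hβinj a
  exact ⟨α b, hβ b⟩

theorem FixesSmall.exists_apex_of_chain_vertex [Nonempty F] [Nonempty {f // ¬ ρ f f}]
    (hφ : FixesSmall φ) {W : Type} [Finite W] [Nonempty W] {s : W → W → Prop}
    (h : φ (ofRel ρ) = ofRel s) {m : ℕ} {w : Fin m → F → Prop × Prop}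
    (γ : s ↪r join (· ≤ ·) w ρ) {z : W} {i : Fin m} (hz : γ z = .inl i) :
    ∃ b, ρ b b ∧ ∀ c, {a : {f // ¬ ρ f f} | w i a = c}.ncard ≤
      {a : {f // ¬ ρ f f} | edgeLabel ρ b a = c}.ncard := by
  obtain ⟨α⟩ := ofRel_le_ofRel.1 (h ▸ (le_map_iff_of_isFixedPt (hφ.isFixedPt_loopless
    (ρ := looplessPart ρ) fun a => a.2)).2 (ofRel_le_of_embedding (Subrel.relEmbedding ρ _)))
  let κ : join (fun _ _ : Unit => True) (fun _ a => w i a.1) (looplessPart ρ) ↪r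
      join (· ≤ ·) w ρ :=
    joinMap ⟨⟨fun _ => i, fun _ _ _ => rfl⟩, by simp⟩ (Subrel.relEmbedding ρ _) fun _ _ => rfl
  have hκ : Set.range κ ⊆ Set.range γ := by
    rintro _ ⟨_ | a, rfl⟩
    exacts [⟨z, hz⟩, exists_eq_inr_of_looplessPart γ α a]
  exact hφ.exists_apex (h ▸ ofRel_le_of_range_subset κ γ hκ)

theorem FixesSmall.isFixedPt_of_card_le [Nonempty F] (hφ : FixesSmall φ)
    (h3 : 3 ≤ Nat.card {f // ¬ ρ f f})
    (hle : Nat.card {f // ρ f f} ≤ Nat.card {f // ¬ ρ f f}) : IsFixedPt φ (ofRel ρ) := by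
  have : Nonempty {f // ¬ ρ f f} := (Nat.card_pos_iff.1 (by omega)).1
  obtain ⟨v, ⟨x, y, hxy⟩, hv⟩ := exists_word_not_dominated h3 hle (L := Prop × Prop) (by simp)
    fun b a => edgeLabel ρ b.1 a.1
  obtain ⟨m, w, hfix, hw⟩ := hφ.exists_join_chain_perm hxy
  obtain ⟨W, _, _, s, h⟩ := exists_eq_ofRel (φ (ofRel ρ))
  have hle : φ (ofRel ρ) ≤ ofRel (join (· ≤ ·) w ρ) := by
    rw [← hfix.eq, φ.le_iff_le]
    exact ofRel_le_of_embedding (joinInr _ w ρ)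
  obtain ⟨γ⟩ := ofRel_le_ofRel.1 (h ▸ hle)
  refine isFixedPt_of_map_le (h ▸ ofRel_le_of_range_subset γ (joinInr _ w ρ) ?_)
  rintro _ ⟨z, rfl⟩
  rcases hz : γ z with i | f
  · obtain ⟨b, hb, hdom⟩ := hφ.exists_apex_of_chain_vertex h γ hz
    obtain ⟨c, hc⟩ := hv ⟨b, hb⟩
    obtain ⟨σ, hσ⟩ := hw i
    have hperm : {a : {f // ¬ ρ f f} | w i a = c}.ncard = (v ⁻¹' {c}).ncard := by
      simp only [hσ]
      exact Set.ncard_preimage_of_injective_subset_range (s := v ⁻¹' {c}) σ.injective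
        fun a _ => σ.surjective a
    exact absurd (hperm ▸ hdom c) hc.not_ge
  · exact ⟨f, rfl⟩

theorem FixesSmall.apply_eq (hφ : FixesSmall φ) (x : DigraphType) : φ x = x := by
  obtain ⟨V, _, _, r, rfl⟩ := exists_eq_ofRel x
  by_cases hV : Nat.card V ≤ 4
  · exact hφ.isFixedPt_ofRel hV
  have hsum : {v | r v v}.ncard + {v | ¬ r v v}.ncard = Nat.card V :=
    Set.ncard_add_ncard_compl _
  simp only [← Nat.card_coe_set_eq, Set.coe_ofPred] at hsum
  obtain h | h := le_total (Nat.card {v // r v v}) (Nat.card {v // ¬ r v v})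
  · exact hφ.isFixedPt_of_card_le (by omega) h
  · refine isFixedPt_of_conj_complLoopsIso (hφ.conj_complLoopsIso.isFixedPt_of_card_le ?_ ?_) <;>
      simp only [loopCompl_self, not_not] <;> omega

end Fixed

end DigraphType

theorem theorem3 : Finite (DigraphType ≃o DigraphType) := by
  have := DigraphType.finite_size_le 4
  let f (φ : DigraphType ≃o DigraphType) (x : {x : DigraphType // x.size ≤ 4}) :
      {x : DigraphType // x.size ≤ 4} := ⟨φ x, by rw [DigraphType.size_map]; exact x.2⟩
  refine Finite.of_injective f fun φ ψ h => ?_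
  have hfix : DigraphType.FixesSmall (φ.trans ψ.symm) := fun x hx => by
    rw [IsFixedPt, OrderIso.trans_apply, OrderIso.symm_apply_eq]
    exact Subtype.ext_iff.1 (congrFun h ⟨x, hx⟩)
  ext x
  exact ψ.symm_apply_eq.1 (hfix.apply_eq x)
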